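/- Let $H$ be a finite hypergraph: finite sets of hypervertices $V$ and hyperedges $E$, where each hyperedge is a nonempty subset of $V$, the union of the hyperedges is $V$, and hyperedges may be repeated. A closed path of length $k\ge 1$ in $H$ is a sequence $(v_1,e_1,v_2,e_2,\dots,v_k,e_k,v_1)$ with $v_i,v_{i+1}\in e_i$ and $v_i\ne v_{i+1}$ for all $i$ (indices modulo $k$). It has hyperedge backtracking if it contains consecutive terms $(e,v,e)$. Write $c^m$ for the closed path obtained by going around $c$ $m$ times. A closed path $c$ is a primitive cycle if neither $c$ nor $c^2$ has hyperedge backtracking and $c\neq b^m$ for every closed path $b$ and every $m\ge 2$. Prime cycles are the equivalence classes of primitive cycles under cyclic permutation; $P$ is the set of prime cycles and $|\mathfrak p|$ is the length of $\mathfrak p$. Then for $u\in\mathbb C$ with $|u|$ sufficiently small the product $$\zeta_H(u)=\prod_{\mathfrak p\in P}\bigl(1-u^{|\mathfrak p|}\bigr)^{-1}$$ converges (unconditionally), and $\zeta_H$ extends uniquely to a meromorphic function on $\mathbb C$, again denoted $\zeta_H$. This extension satisfies $\zeta_H(u)=\zeta_H(-u)$ for all $u\in\mathbb C$ (as meromorphic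 functions, so that poles correspond to poles) if and only if every primitive cycle in $H$ has even length. -/

import Mathlib

open Filter Topology

/-- A hypergraph with hypervertices `V` and hyperedges indexed by `E`. Hyperedges are nonempty sets
of hypervertices, their union is all of `V`, and they may repeat (`edge` need not be injective). -/
structure MultiHypergraph (V E : Type*) where
  edge : E → Set V
  edge_nonempty : ∀ e, (edge e).Nonempty
  exists_edge : ∀ v, ∃ e, v ∈ edge e

namespace MultiHypergraph

variable {V E : Type*} (H : MultiHypergraph V E)

/-- The sequence `(v₁, e₁, v₂, e₂, …, v_k, e_k, v₁)` is encoded by the list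
`[(v₁, e₁), …, (v_k, e_k)]`. It is a closed path of length `k ≥ 1` if every step (cyclically) goes
from `v_i` to a different hypervertex `v_{i+1}` of the same hyperedge `e_i`. -/
def IsClosedPath (c : List (V × E)) : Prop :=
  c ≠ [] ∧ (∀ x ∈ c, x.1 ∈ H.edge x.2) ∧
    Cycle.Chain (fun x y : V × E => y.1 ∈ H.edge x.2 ∧ x.1 ≠ y.1) (c : Cycle (V × E))

/-- Hyperedge backtracking: the sequence contains consecutive terms `(e, v, e)`. -/
def HasHyperedgeBacktracking (c : List (V × E)) : Prop :=
  ∃ x y : V × E, [x, y] <:+: c ∧ x.2 = y.2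

/-- The `m`-multiple of a closed path: go around it `m` times. -/
def multiple (m : ℕ) (c : List (V × E)) : List (V × E) :=
  (List.replicate m c).flatten

def IsTailless (c : List (V × E)) : Prop :=
  ¬ HasHyperedgeBacktracking (multiple 2 c)

def IsPrimitiveCycle (c : List (V × E)) : Prop :=
  H.IsClosedPath c ∧ ¬ HasHyperedgeBacktracking c ∧ IsTailless c ∧
    ¬ ∃ (b : List (V × E)) (m : ℕ), H.IsClosedPath b ∧ 2 ≤ m ∧ c = multiple m b

/-- Prime cycles: the classes of primitive cycles modulo cyclic permutation (`Cycle α` is the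
quotient of `List α` by cyclic permutation; the direction of travel is remembered). -/
def PrimeCycle : Type _ :=
  {p : Cycle (V × E) // ∃ c : List (V × E), H.IsPrimitiveCycle c ∧ (c : Cycle (V × E)) = p}

def PrimeCycle.length {H : MultiHypergraph V E} (p : H.PrimeCycle) : ℕ :=
  Cycle.length p.val

/-- `Z` is the zeta function on the whole plane: it is meromorphic on `ℂ`, and for all `u` near `0`
the Euler product `∏ (1 - u ^ |p|)⁻¹` over the prime cycles converges to `Z u`. Normal form means
that `Z` takes its continuous value wherever there is one, and the value `0` at the poles. -/
def IsZeta (Z : ℂ → ℂ) : Prop :=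
  MeromorphicNFOn Z Set.univ ∧
    ∀ᶠ u in 𝓝 (0 : ℂ), HasProd (fun p : H.PrimeCycle => (1 - u ^ p.length)⁻¹) (Z u)

open Classical in
/-- The generalized Ihara-Selberg zeta function, continued to the whole plane. -/
noncomputable def zeta : ℂ → ℂ :=
  if h : ∃ Z, H.IsZeta Z then h.choose else 0

end MultiHypergraph

/-!
The zeta function of a finite hypergraph is the inverse of a polynomial. Let `A` be the 0-1 matrix,
indexed by pairs `(v, e)`, of the relation "`(w, f)` may follow `(v, e)`": `v` and `w` are different
hypervertices of `e`, and `f ≠ e`. Primitive cycles are then the closed chains of this relation that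
are not repetitions of a shorter list (`MultiHypergraph.isPrimitiveCycle_iff`), and the identity
`∏ (1 - u ^ |p|)⁻¹ = det (1 - u A)⁻¹` for small `u` is shown by comparing two expansions of the
logarithm.

* `eventually_hasSum_trace_pow`: `det (1 - u A)⁻¹ = exp (∑ tr (A ^ k) u ^ k / k)`, from Jacobi's
  formula for the derivative of the determinant. As `tr (A ^ k)` is the number of closed chains with
  `k` entries (`card_cycleChain`), the exponent is the sum of `u ^ |c| / |c|` over all closed
  chains `c`.
* Each closed chain is a power of exactly one aperiodic closed chain (`aperiodicPowerEquiv`), and the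
  rotation class of an aperiodic list has as many members as the list has entries
  (`List.IsAperiodic.card_isRotated`). So the same sum is `∑ -log (1 - u ^ |p|)` over the prime
  cycles `p`, and exponentiating it gives the Euler product
  (`eventually_hasProd_rotationClass`).

Uniqueness of the continuation is the identity theorem for meromorphic functions in normal form.

If all primitive cycles have even length, then the Euler product is even near `0`, hence so is the
polynomial `det (1 - u A)` on the whole plane. Conversely, for small `t > 0` each Euler factor at `t`
is at least the one at `-t`, with strict inequality for odd lengths, and the product at `t` is
positive; so equality of the two products excludes odd lengths (`MultiHypergraph.IsZeta.even_length`).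
-/

/-! ### Powers and rotations of lists -/

namespace List

variable {α : Type*}

/-- The concatenation of `m` copies of a list. -/
def power (m : ℕ) (c : List α) : List α :=
  (replicate m c).flatten

@[simp] theorem power_zero (c : List α) : power 0 c = [] := rfl

theorem power_succ (m : ℕ) (c : List α) : power (m + 1) c = c ++ power m c := by
  simp [power, replicate_succ]

@[simp] theorem power_one (c : List α) : power 1 c = c := by
  simp [power]

@[simp] theorem length_power (m : ℕ) (c : List α) : (power m c).length = m * c.length := by
  simp [power]

theorem power_add (m k : ℕ) (c : List α) : power (m + k) c = power m c ++ power k c := by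
  induction m with
  | zero => simp
  | succ m ih => rw [Nat.succ_add, power_succ, power_succ, ih, append_assoc]

theorem power_power (m k : ℕ) (c : List α) : power m (power k c) = power (m * k) c := by
  induction m with
  | zero => simp
  | succ m ih => rw [power_succ, ih, Nat.succ_mul, Nat.add_comm, power_add]

theorem rotate_length_power (m : ℕ) (c : List α) : (power m c).rotate c.length = power m c := by
  cases m with
  | zero => simp
  | succ m => rw [power_succ, rotate_append_length_eq, ← power_succ, power_add, power_one]

/-- If `r` commutes with `t`, then `t` is a prefix of `r` as long as `r` is at least as long; it can be
split off repeatedly. -/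
theorem eq_power_of_append_comm {t r : List α} {k : ℕ} (h : t ++ r = r ++ t)
    (hk : r.length = k * t.length) : r = power k t := by
  induction k generalizing r with
  | zero => simpa using hk
  | succ k ih =>
    have hle : t.length ≤ r.length := by rw [hk]; exact Nat.le_mul_of_pos_left _ k.succ_pos
    obtain ⟨s, rfl⟩ : t <+: r :=
      prefix_of_prefix_length_le (h ▸ prefix_append t r) (prefix_append r t) hle
    rw [append_assoc, append_cancel_left_eq] at h
    rw [power_succ, ← ih h]
    rw [length_append, Nat.succ_mul] at hk
    omega

theorem eq_power_take_of_rotate_eq {c : List α} {d : ℕ} (hd : d ∣ c.length)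
    (h : c.rotate d = c) : c = power (c.length / d) (c.take d) := by
  obtain ⟨k, hk⟩ := hd
  rcases Nat.eq_zero_or_pos c.length with h0 | hpos
  · rw [length_eq_zero_iff] at h0
    simp [h0, power]
  have hd0 : 0 < d := Nat.pos_of_ne_zero fun h0 => by rw [h0, zero_mul] at hk; omega
  have hk0 : 0 < k := Nat.pos_of_ne_zero fun h0 => by rw [h0, mul_zero] at hk; omega
  have hdle : d ≤ c.length := by rw [hk]; exact Nat.le_mul_of_pos_right _ hk0
  rw [rotate_eq_drop_append_take hdle] at h
  obtain ⟨k, rfl⟩ : ∃ j, k = j + 1 := ⟨k - 1, by omega⟩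
  have hr : c.drop d = power k (c.take d) := by
    apply eq_power_of_append_comm
    · rw [h, take_append_drop]
    · rw [length_drop, length_take, min_eq_left hdle, hk, Nat.mul_succ, Nat.mul_comm k]
      omega
  rw [hk, Nat.mul_div_cancel_left _ hd0, power_succ, ← hr, take_append_drop]

theorem rotate_gcd_eq_self {c : List α} {i j : ℕ} (hi : c.rotate i = c) (hj : c.rotate j = c) :
    c.rotate (i.gcd j) = c := by
  have key : ∀ n, (fun l : List α => l.rotate 1)^[n] c = c.rotate n := by
    intro n
    induction n with
    | zero => simp
    | succ n ih => rw [Function.iterate_succ_apply', ih, rotate_rotate]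
  have := Function.IsPeriodicPt.gcd (f := fun l : List α => l.rotate 1) (x := c) (m := i) (n := j)
    ((key i).trans hi) ((key j).trans hj)
  exact (key _).symm.trans this

/-- A list is aperiodic if it is not a repetition of a shorter list. The empty list, being its own
double, is not aperiodic. -/
def IsAperiodic (c : List α) : Prop :=
  ∀ (b : List α) (m : ℕ), 2 ≤ m → c ≠ power m b

theorem IsAperiodic.ne_nil {c : List α} (h : c.IsAperiodic) : c ≠ [] := by
  rintro rfl
  exact h [] 2 le_rfl (by simp [power])

/-- A list is aperiodic exactly if it has as many rotations as entries; in this form the property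
is visibly invariant under rotation. -/
theorem isAperiodic_iff {c : List α} :
    c.IsAperiodic ↔ c ≠ [] ∧ ∀ j, c.rotate j = c → c.length ∣ j := by
  constructor
  · refine fun h => ⟨h.ne_nil, fun j hj => ?_⟩
    have hg := rotate_gcd_eq_self hj (rotate_length c)
    have hdvd : j.gcd c.length ∣ c.length := Nat.gcd_dvd_right _ _
    have hc := eq_power_take_of_rotate_eq hdvd hg
    have hpos : 0 < c.length := length_pos_of_ne_nil h.ne_nil
    have hgpos : 0 < j.gcd c.length := Nat.gcd_pos_of_pos_right _ hpos
    have hlt : c.length / j.gcd c.length < 2 := by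
      by_contra hcon
      exact h _ _ (not_lt.1 hcon) hc
    have h1 : 0 < c.length / j.gcd c.length := Nat.div_pos (Nat.le_of_dvd hpos hdvd) hgpos
    have h2 : c.length = j.gcd c.length :=
      Nat.eq_of_dvd_of_div_eq_one hdvd (by omega) |>.symm
    exact Nat.gcd_eq_right_iff_dvd.1 h2.symm
  · rintro ⟨hne, h⟩ b m hm rfl
    have hd := h _ (rotate_length_power m b)
    rw [length_power] at hd
    rcases Nat.eq_zero_or_pos b.length with h0 | hpos
    · exact hne (length_eq_zero_iff.1 (by simp [h0]))
    · have := Nat.le_of_dvd hpos hd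
      nlinarith

theorem IsAperiodic.rotate {c : List α} (h : c.IsAperiodic) (k : ℕ) :
    (c.rotate k).IsAperiodic := by
  rw [isAperiodic_iff] at h ⊢
  refine ⟨by simpa using h.1, fun j hj => ?_⟩
  rw [length_rotate]
  refine h.2 j (rotate_injective k ?_)
  simpa [rotate_rotate, Nat.add_comm] using hj

theorem IsAperiodic.rotate_inj {c : List α} (h : c.IsAperiodic) {i j : ℕ} (hi : i < c.length)
    (hj : j < c.length) (hij : c.rotate i = c.rotate j) : i = j := by
  wlog hle : i ≤ j generalizing i j
  · exact (this hj hi hij.symm (le_of_not_ge hle)).symm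
  have h1 : c.rotate (j - i) = c := by
    refine rotate_injective i ?_
    simp only [rotate_rotate]
    rw [Nat.sub_add_cancel hle, hij]
  have h2 := Nat.eq_zero_of_dvd_of_lt ((isAperiodic_iff.1 h).2 _ h1) (by omega)
  omega

/-- The rotation class of an aperiodic list of length `n` has `n` members. -/
theorem IsAperiodic.card_isRotated {c : List α} (h : c.IsAperiodic) :
    Nat.card {b : List α // b ~r c} = c.length := by
  rw [← Nat.card_fin c.length]
  symm
  refine Nat.card_eq_of_bijective
    (fun i : Fin c.length => (⟨c.rotate i, (IsRotated.forall c i)⟩ : {b : List α // b ~r c}))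
    ⟨fun i j hij => ?_, fun ⟨b, hb⟩ => ?_⟩
  · exact Fin.ext (h.rotate_inj i.2 j.2 (congrArg Subtype.val hij))
  · obtain ⟨k, rfl⟩ := hb.symm
    refine ⟨⟨k % c.length, Nat.mod_lt _ (length_pos_of_ne_nil h.ne_nil)⟩, Subtype.ext ?_⟩
    exact rotate_mod c k

theorem exists_isAperiodic_power {c : List α} (hc : c ≠ []) :
    ∃ (b : List α) (m : ℕ), b.IsAperiodic ∧ c = power (m + 1) b := by
  induction hn : c.length using Nat.strong_induction_on generalizing c with
  | _ n ih =>
    by_cases h : c.IsAperiodic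
    · exact ⟨c, 0, h, by simp⟩
    · simp only [IsAperiodic, not_forall, not_not] at h
      obtain ⟨b, m, hm, rfl⟩ := h
      have hb : b ≠ [] := by rintro rfl; exact hc (by simp [power])
      have hlt : b.length < n := by
        rw [← hn, length_power]
        have := length_pos_of_ne_nil hb
        nlinarith
      obtain ⟨d, k, hd, rfl⟩ := ih _ hlt hb rfl
      refine ⟨d, m * (k + 1) - 1, hd, ?_⟩
      rw [power_power, Nat.sub_add_cancel (Nat.mul_pos (by omega) k.succ_pos)]

theorem take_power {b : List α} {k m : ℕ} (h : k ≤ m) :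
    (power m b).take (k * b.length) = power k b := by
  obtain ⟨j, rfl⟩ := Nat.exists_eq_add_of_le h
  rw [power_add, ← length_power, take_left]

/-- The aperiodic root of a list is unique: two roots give two periods, hence their `gcd` is a
period too, and both roots are powers of the same prefix. -/
theorem power_succ_inj {b b' : List α} (hb : b.IsAperiodic) (hb' : b'.IsAperiodic) {m m' : ℕ}
    (h : power (m + 1) b = power (m' + 1) b') : b = b' ∧ m = m' := by
  set g := b.length.gcd b'.length with hg
  have hgb : g ∣ b.length := Nat.gcd_dvd_left _ _
  have hgb' : g ∣ b'.length := Nat.gcd_dvd_right _ _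
  have hrot : (power (m + 1) b).rotate g = power (m + 1) b :=
    rotate_gcd_eq_self (rotate_length_power _ _) (by rw [h]; exact rotate_length_power _ _)
  have hpb : 0 < b.length := length_pos_of_ne_nil hb.ne_nil
  have hpb' : 0 < b'.length := length_pos_of_ne_nil hb'.ne_nil
  have hg0 : 0 < g := Nat.gcd_pos_of_pos_left _ hpb
  have hroot := eq_power_take_of_rotate_eq (by rw [length_power]; exact hgb.mul_left _) hrot
  set N := (power (m + 1) b).length / g
  set t := (power (m + 1) b).take g with ht
  have hdlen : g ∣ (power (m + 1) b).length := by rw [length_power]; exact hgb.mul_left _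
  have htl : t.length = g := by
    rw [ht, length_take, min_eq_left]
    refine Nat.le_of_dvd ?_ hdlen
    rw [length_power]; positivity
  -- An aperiodic root `d` is a power of the prefix `t`, so it equals `t`.
  have key : ∀ {d : List α} {k : ℕ}, d.IsAperiodic → g ∣ d.length →
      power (m + 1) b = power (k + 1) d → d.length = g := by
    intro d k hd hgd hk
    have hpd : 0 < d.length := length_pos_of_ne_nil hd.ne_nil
    have h1 : d = power (d.length / g) t := by
      have hle : d.length / g ≤ N := by
        refine Nat.div_le_div_right ?_
        rw [hk, length_power]
        exact Nat.le_mul_of_pos_left _ k.succ_pos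
      have h2 := take_power (b := t) hle
      rw [htl, Nat.div_mul_cancel hgd, ← hroot, hk] at h2
      have h3 := take_power (b := d) (k := 1) (m := k + 1) (by omega)
      rw [one_mul, power_one] at h3
      rw [← h2, h3]
    have h4 : d.length / g < 2 := by
      by_contra hcon
      exact hd _ _ (not_lt.1 hcon) h1
    have h5 : 0 < d.length / g := Nat.div_pos (Nat.le_of_dvd hpd hgd) hg0
    exact (Nat.eq_of_dvd_of_div_eq_one hgd (by omega)).symm
  have e1 := key hb hgb rfl
  have e2 := key hb' hgb' h
  have hlen : b.length = b'.length := e1.trans e2.symm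
  constructor
  · have h1 := take_power (b := b) (k := 1) (m := m + 1) (by omega)
    have h2 := take_power (b := b') (k := 1) (m := m' + 1) (by omega)
    rw [one_mul, power_one] at h1 h2
    rw [← h1, ← h2, h, hlen]
  · have := congrArg length h
    rw [length_power, length_power, hlen] at this
    have := Nat.eq_of_mul_eq_mul_right hpb' this
    omega

/-! ### Closed chains -/

theorem cycleChain_iff {r : α → α → Prop} {c : List α} (hc : c ≠ []) :
    Cycle.Chain r (c : Cycle α) ↔
      IsChain r c ∧ ∀ x ∈ c.getLast?, ∀ y ∈ c.head?, r x y := by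
  obtain ⟨a, l, rfl⟩ := exists_cons_of_ne_nil hc
  rw [Cycle.chain_coe_cons, ← cons_append, isChain_append]
  simp

theorem head?_power_succ {m : ℕ} {b : List α} (hb : b ≠ []) :
    (power (m + 1) b).head? = b.head? := by
  rw [power_succ, head?_append_of_ne_nil _ hb]

theorem getLast?_power_succ {m : ℕ} {b : List α} (hb : b ≠ []) :
    (power (m + 1) b).getLast? = b.getLast? := by
  rw [power_add, power_one, getLast?_append_of_ne_nil _ hb]

theorem cycleChain_power_succ {r : α → α → Prop} {m : ℕ} {b : List α} (hb : b ≠ []) :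
    Cycle.Chain r (power (m + 1) b : Cycle α) ↔ Cycle.Chain r (b : Cycle α) := by
  have hb' : power (m + 1) b ≠ [] := by simp [power_succ, hb]
  rw [cycleChain_iff hb, cycleChain_iff hb', head?_power_succ hb, getLast?_power_succ hb]
  refine and_congr_left fun h => ?_
  clear hb'
  induction m with
  | zero => simp
  | succ m ih =>
    rw [power_succ, isChain_append, ih, head?_power_succ hb]
    exact ⟨fun h' => h'.1, fun h' => ⟨h', h', h⟩⟩

end List

/-! ### Closed chains and traces of powers of the adjacency matrix -/

section Walks

open scoped Classical in
/-- The adjacency matrix of a relation, with complex entries. -/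
noncomputable def relMatrix {α : Type*} (r : α → α → Prop) : Matrix α α ℂ :=
  Matrix.of fun x y => if r x y then 1 else 0

theorem finite_cycleChain {α : Type*} [Finite α] (r : α → α → Prop) (n : ℕ) :
    Finite {c : List α // c.length = n ∧ Cycle.Chain r (c : Cycle α)} :=
  Set.Finite.subset (List.finite_length_eq α n) fun _ hc => hc.1

variable {α : Type*} [Fintype α] [DecidableEq α]

open scoped Classical in
/-- The walks with `n` steps from `i` to `j` along `r`, each as the list of its vertices after the
initial vertex `i`. -/
noncomputable def walks (r : α → α → Prop) : ℕ → α → α → Finset (List α)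
  | 0, i, j => if i = j then {[]} else ∅
  | n + 1, i, j => Finset.univ.biUnion fun k =>
      if r i k then (walks r n k j).map ⟨List.cons k, List.cons_injective⟩ else ∅

theorem mem_walks {r : α → α → Prop} {n : ℕ} {i j : α} {l : List α} :
    l ∈ walks r n i j ↔ l.length = n ∧ List.IsChain r (i :: l) ∧
      (i :: l).getLast (List.cons_ne_nil i l) = j := by
  classical
  induction n generalizing i l with
  | zero =>
    rw [walks, List.length_eq_zero_iff]
    split_ifs with h
    · rw [Finset.mem_singleton]
      refine ⟨?_, fun h' => h'.1⟩
      rintro rfl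
      simpa using h
    · simp only [Finset.notMem_empty, false_iff]
      rintro ⟨rfl, -, h'⟩
      exact h (by simpa using h')
  | succ n ih =>
    rw [walks, Finset.mem_biUnion]
    constructor
    · rintro ⟨k, -, hk⟩
      split_ifs at hk with h
      · rw [Finset.mem_map] at hk
        obtain ⟨l, hl, rfl⟩ := hk
        obtain ⟨h1, h2, h3⟩ := ih.1 hl
        refine ⟨by simp [h1], List.IsChain.cons_cons h h2, ?_⟩
        simpa using h3
      · simp at hk
    · rintro ⟨h1, h2, h3⟩
      obtain ⟨k, l, rfl⟩ := List.exists_cons_of_length_eq_add_one h1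
      rw [List.isChain_cons_cons] at h2
      refine ⟨k, Finset.mem_univ _, ?_⟩
      rw [if_pos h2.1, Finset.mem_map]
      exact ⟨l, ih.2 ⟨by simpa using h1, h2.2, by simpa using h3⟩, rfl⟩

theorem card_walks (r : α → α → Prop) (n : ℕ) (i j : α) :
    ((walks r n i j).card : ℂ) = (relMatrix r ^ n) i j := by
  classical
  induction n generalizing i with
  | zero =>
    rw [walks, pow_zero, Matrix.one_apply]
    split_ifs <;> simp
  | succ n ih =>
    rw [walks, Finset.card_biUnion, pow_succ', Matrix.mul_apply, Nat.cast_sum]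
    · refine Finset.sum_congr rfl fun k _ => ?_
      rw [← ih, relMatrix, Matrix.of_apply]
      split_ifs <;> simp
    · intro k _ k' _ hne
      rw [Function.onFun, Finset.disjoint_left]
      intro l hl hl'
      split_ifs at hl hl'
      · rw [Finset.mem_map] at hl hl'
        obtain ⟨s, -, rfl⟩ := hl
        obtain ⟨s', -, hs'⟩ := hl'
        exact hne (List.cons.inj hs').1.symm
      all_goals simp_all

/-- Closed chains with `n + 1` entries correspond to walks with `n + 1` steps from a vertex (the last
entry of the list) to itself, which the trace of the `(n + 1)`-st power of the matrix counts. -/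
theorem card_cycleChain (r : α → α → Prop) (n : ℕ) :
    (Nat.card {c : List α // c.length = n + 1 ∧ Cycle.Chain r (c : Cycle α)} : ℂ) =
      (relMatrix r ^ (n + 1)).trace := by
  classical
  have h : ∀ c : List α, (c.length = n + 1 ∧ Cycle.Chain r (c : Cycle α)) ↔
      c ∈ Finset.univ.biUnion fun i => walks r (n + 1) i i := by
    intro c
    simp only [Finset.mem_biUnion, Finset.mem_univ, true_and, mem_walks, exists_and_left]
    refine and_congr_right fun hlen => ?_
    have hne : c ≠ [] := by rintro rfl; simp at hlen
    rw [Cycle.chain_ne_nil r hne]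
    constructor
    · exact fun hc => ⟨c.getLast hne, hc, by rw [List.getLast_cons hne]⟩
    · rintro ⟨i, hc, hi⟩
      rw [List.getLast_cons hne] at hi
      rwa [hi]
  rw [Nat.card_congr (Equiv.subtypeEquivRight h), Nat.card_eq_fintype_card, Fintype.card_coe,
    Finset.card_biUnion, Nat.cast_sum]
  · exact Finset.sum_congr rfl fun i _ => card_walks r (n + 1) i i
  · intro i _ j _ hne
    rw [Function.onFun, Finset.disjoint_left]
    intro l hl hl'
    rw [mem_walks] at hl hl'
    have hl0 : l ≠ [] := by rintro rfl; simp at hl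
    rw [List.getLast_cons hl0] at hl hl'
    exact hne (hl.2.2.symm.trans hl'.2.2)

end Walks

/-! ### The determinant as the exponential of a trace series -/

section Determinant

/-- The geometric series for the inverse of `1 - v a`, seen through a bounded linear functional. -/
theorem exists_inverse_hasSum_of_norm_smul_lt_one {𝔸 : Type*} [NormedRing 𝔸] [NormedAlgebra ℂ 𝔸]
    [CompleteSpace 𝔸] (T : 𝔸 →ₗ[ℂ] ℂ) {C : ℝ} (hT : ∀ x, ‖T x‖ ≤ C * ‖x‖) {a : 𝔸} {v : ℂ}
    (hv : ‖v • a‖ < 1) :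
    ∃ b : 𝔸, (1 - v • a) * b = 1 ∧ HasSum (fun k : ℕ => T (a ^ (k + 1)) * v ^ k) (T (b * a)) := by
  refine ⟨∑' k, (v • a) ^ k, mul_neg_geom_series _ hv, ?_⟩
  have hs := ((summable_geometric_of_norm_lt_one hv).hasSum.mul_right a).mapL (T.mkContinuous C hT)
  have heq : (fun k : ℕ => T (a ^ (k + 1)) * v ^ k) =
      fun k => T.mkContinuous C hT ((v • a) ^ k * a) := by
    funext k
    rw [LinearMap.mkContinuous_apply, smul_pow, smul_mul_assoc, ← pow_succ, map_smul, smul_eq_mul,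
      mul_comm]
  rw [heq]
  exact hs

open Matrix

variable {n : Type*} [Fintype n] [DecidableEq n]

/-- **Jacobi's formula** along the pencil `1 - u A`, at a point where it has the inverse `B`. -/
theorem hasDerivAt_det_one_sub_smul {A B : Matrix n n ℂ} {u : ℂ} (h : (1 - u • A) * B = 1) :
    HasDerivAt (fun v : ℂ => (1 - v • A).det) (-((1 - u • A).det * (B * A).trace)) u := by
  set p : Polynomial ℂ :=
    (1 + (Polynomial.X : Polynomial ℂ) • (-(B * A)).map Polynomial.C).det with hp
  have hp' : p.derivative.eval 0 = -(B * A).trace := by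
    rw [hp, derivative_det_one_add_X_smul, trace_neg]
  have hpe : ∀ t : ℂ, p.eval t = (1 + t • (-(B * A))).det := by
    intro t
    rw [hp, ← Polynomial.coe_evalRingHom, RingHom.map_det]
    congr 1
    ext i j
    by_cases hij : i = j <;> simp [hij] <;> ring
  have hfac : (fun v : ℂ => (1 - v • A).det) =
      fun v => (1 - u • A).det * p.eval (v - u) := by
    funext v
    rw [hpe, ← det_mul]
    congr 1
    have : (1 - u • A) * (1 + (v - u) • (-(B * A))) =
        (1 - u • A) - (v - u) • (((1 - u • A) * B) * A) := by
      rw [mul_add, mul_one, mul_smul_comm, mul_neg, ← mul_assoc, smul_neg]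
      abel
    rw [this, h, one_mul, sub_smul]
    abel
  rw [hfac, ← mul_neg, ← hp']
  refine HasDerivAt.const_mul _ ?_
  refine HasDerivAt.comp_sub_const (f := fun t => p.eval t) u u ?_
  rw [sub_self]
  exact p.hasDerivAt 0

theorem analyticAt_det_one_sub_smul (A : Matrix n n ℂ) (u : ℂ) :
    AnalyticAt ℂ (fun v : ℂ => (1 - v • A).det) u := by
  have h : (fun v : ℂ => (1 - v • A).det) = fun v => A.charpolyRev.eval v := by
    funext v
    rw [charpolyRev, ← Polynomial.coe_evalRingHom, RingHom.map_det]
    congr 1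
    ext i j
    by_cases hij : i = j <;> simp [hij] <;> ring
  rw [h]
  exact A.charpolyRev.differentiable.analyticAt u

omit [DecidableEq n] in
theorem norm_entry_le_linfty_opNorm (M : Matrix n n ℂ) (i j : n) :
    ‖M i j‖ ≤ @norm _ Matrix.linftyOpNormedAddCommGroup.toNorm M := by
  rw [linfty_opNorm_def]
  refine le_trans ?_ (NNReal.coe_le_coe.2 (Finset.le_sup (f := fun i => ∑ j, ‖M i j‖₊)
    (Finset.mem_univ i)))
  rw [← coe_nnnorm, NNReal.coe_le_coe]
  exact Finset.single_le_sum (f := fun j => ‖M i j‖₊) (fun _ _ => zero_le) (Finset.mem_univ j)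

attribute [local instance] Matrix.linftyOpNormedRing Matrix.linftyOpNormedAlgebra

/-- The identity `det (1 - u A)⁻¹ = exp (∑ tr (A ^ k) u ^ k / k)` for small `u`: by Jacobi's formula
and the geometric series for `(1 - u A)⁻¹`, the product of `det (1 - u A)` with the exponential has
derivative zero. -/
theorem eventually_hasSum_trace_pow (A : Matrix n n ℂ) :
    ∀ᶠ u in 𝓝 (0 : ℂ), ∃ L : ℂ,
      HasSum (fun k : ℕ => (A ^ (k + 1)).trace * (u ^ (k + 1) / (k + 1))) L ∧
        Complex.exp L = ((1 - u • A).det)⁻¹ := by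
  set C : ℝ := (Fintype.card n : ℝ)
  have hT : ∀ M : Matrix n n ℂ, ‖traceLinearMap n ℂ ℂ M‖ ≤ C * ‖M‖ := fun M => by
    rw [traceLinearMap_apply, trace, ← nsmul_eq_mul, ← Finset.card_univ]
    exact (norm_sum_le _ _).trans (Finset.sum_le_card_nsmul _ _ _ fun i _ =>
      norm_entry_le_linfty_opNorm M i i)
  -- On the ball of radius `ε`, `‖u A‖ ≤ 1 / 2`.
  set ε : ℝ := (2 * (‖A‖ + 1))⁻¹ with hε
  have hε0 : 0 < ε := by positivity
  have hAε : ‖A‖ * ε ≤ 1 / 2 := by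
    rw [hε, mul_inv, ← mul_assoc, mul_comm ‖A‖, mul_assoc]
    have : ‖A‖ * (‖A‖ + 1)⁻¹ ≤ 1 := by
      rw [← div_eq_mul_inv, div_le_one (by positivity)]; linarith
    linarith
  set B : Set ℂ := Metric.ball 0 ε with hB
  have hmem : ∀ {v : ℂ}, v ∈ B → ‖v‖ ≤ ε := fun hv => (mem_ball_zero_iff.1 hv).le
  have h0 : (0 : ℂ) ∈ B := Metric.mem_ball_self hε0
  set g : ℕ → ℂ → ℂ := fun k v => (A ^ (k + 1)).trace * (v ^ (k + 1) / (k + 1)) with hg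
  set g' : ℕ → ℂ → ℂ := fun k v => (A ^ (k + 1)).trace * v ^ k with hg'
  have hderiv : ∀ k v, v ∈ B → HasDerivAt (g k) (g' k v) v := by
    intro k v _
    refine HasDerivAt.const_mul _ ?_
    have h := (hasDerivAt_pow (k + 1) v).div_const ((k : ℂ) + 1)
    have hk : (k : ℂ) + 1 ≠ 0 := Nat.cast_add_one_ne_zero k
    simpa [mul_div_cancel_left₀ _ hk] using h
  have hbound : ∀ k v, v ∈ B → ‖g' k v‖ ≤ C * ‖A‖ * (1 / 2) ^ k := by
    intro k v hv
    have h1 : ‖(A ^ (k + 1)).trace‖ ≤ C * ‖A‖ ^ (k + 1) :=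
      (hT (A ^ (k + 1))).trans
        (mul_le_mul_of_nonneg_left (norm_pow_le' A k.succ_pos) (Nat.cast_nonneg _))
    calc ‖g' k v‖ = ‖(A ^ (k + 1)).trace‖ * ‖v‖ ^ k := by rw [hg', norm_mul, norm_pow]
      _ ≤ (C * ‖A‖ ^ (k + 1)) * ε ^ k := by
        gcongr
        exact hmem hv
      _ = C * ‖A‖ * (‖A‖ * ε) ^ k := by ring
      _ ≤ C * ‖A‖ * (1 / 2) ^ k := by gcongr
  have hu : Summable fun k : ℕ => C * ‖A‖ * (1 / 2 : ℝ) ^ k :=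
    summable_geometric_two.mul_left _
  have hsum0 : Summable fun k => g k 0 := by
    have : (fun k => g k 0) = 0 := by
      funext k
      simp [hg]
    rw [this]
    exact summable_zero
  have hsum : ∀ v ∈ B, Summable fun k => g k v := fun v hv =>
    summable_of_summable_hasDerivAt_of_isPreconnected hu Metric.isOpen_ball
      (convex_ball 0 ε).isPreconnected hderiv hbound h0 hsum0 hv
  set F : ℂ → ℂ := fun v => (1 - v • A).det * Complex.exp (∑' k, g k v) with hF
  have hFd : ∀ v ∈ B, HasDerivAt F 0 v := by
    intro v hv
    have hG := hasDerivAt_tsum_of_isPreconnected hu Metric.isOpen_ball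
      (convex_ball 0 ε).isPreconnected hderiv hbound h0 hsum0 hv
    have hlt : ‖v • A‖ < 1 := by
      rw [norm_smul]
      have : ‖v‖ * ‖A‖ ≤ ε * ‖A‖ := by gcongr; exact hmem hv
      linarith
    obtain ⟨b, hinv, hb⟩ := exists_inverse_hasSum_of_norm_smul_lt_one _ hT hlt
    have htr : (b * A).trace = ∑' k, g' k v := hb.tsum_eq.symm
    have h := (hasDerivAt_det_one_sub_smul hinv).mul hG.cexp
    rw [htr] at h
    refine HasDerivAt.congr_deriv (f := F) h ?_
    ring
  filter_upwards [Metric.ball_mem_nhds (0 : ℂ) hε0] with v hv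
  refine ⟨_, (hsum v hv).hasSum, ?_⟩
  have hconst : F v = F 0 := Metric.isOpen_ball.is_const_of_deriv_eq_zero
    (convex_ball 0 ε).isPreconnected
    (fun w hw => (hFd w hw).differentiableAt.differentiableWithinAt)
    (fun w hw => (hFd w hw).deriv) hv h0
  have hF0 : F 0 = 1 := by
    have : ∀ k, g k 0 = 0 := fun k => by simp [hg]
    simp [hF, this]
  rw [hF0] at hconst
  exact eq_inv_of_mul_eq_one_right hconst

end Determinant

/-! ### Sums over closed chains and over their rotation classes -/

section EulerProduct

variable {α : Type*}

/-- The logarithm of the determinant as a sum over all closed chains, each closed chain of length `k`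
contributing `u ^ k / k`. -/
theorem eventually_hasSum_cycleChain [Fintype α] [DecidableEq α] (r : α → α → Prop) :
    ∀ᶠ u in 𝓝 (0 : ℂ), ∃ L : ℂ,
      HasSum (fun c : {c : List α // c ≠ [] ∧ Cycle.Chain r (c : Cycle α)} =>
        u ^ c.1.length / (c.1.length : ℂ)) L ∧
        Complex.exp L = ((1 - u • relMatrix r).det)⁻¹ := by
  have hev := eventually_hasSum_trace_pow (relMatrix r)
  have htend : Tendsto (fun u : ℂ => ((‖u‖ : ℝ) : ℂ)) (𝓝 0) (𝓝 0) := by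
    have : Continuous fun u : ℂ => ((‖u‖ : ℝ) : ℂ) := by fun_prop
    simpa using this.tendsto 0
  filter_upwards [hev, htend.eventually hev] with u ⟨L, hL, hexp⟩ ⟨M, hM, _⟩
  refine ⟨L, ?_, hexp⟩
  let ι : ℕ → Type _ := fun k => {c : List α // c.length = k + 1 ∧ Cycle.Chain r (c : Cycle α)}
  have hfin : ∀ k, Finite (ι k) := fun k => finite_cycleChain r (k + 1)
  have := fun k => Fintype.ofFinite (ι k)
  let e : (Σ k, ι k) ≃ {c : List α // c ≠ [] ∧ Cycle.Chain r (c : Cycle α)} :=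
    { toFun := fun x => ⟨x.2.1, by
        have := x.2.2.1
        refine ⟨?_, x.2.2.2⟩
        rintro h0
        rw [h0] at this
        simp at this⟩
      invFun := fun c => ⟨c.1.length - 1, c.1, by
        have := List.length_pos_of_ne_nil c.2.1
        exact ⟨by omega, c.2.2⟩⟩
      left_inv := by
        rintro ⟨k, c, hc, hc'⟩
        have hk : c.length - 1 = k := by omega
        subst hk
        rfl
      right_inv := fun c => rfl }
  have hfib : ∀ (v : ℂ) (k : ℕ), HasSum (fun c : ι k => v ^ c.1.length / (c.1.length : ℂ))
      ((relMatrix r ^ (k + 1)).trace * (v ^ (k + 1) / (k + 1))) := by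
    intro v k
    have h1 : ∀ c : ι k, v ^ c.1.length / (c.1.length : ℂ) = v ^ (k + 1) / (k + 1) := by
      intro c
      rw [c.2.1]
      push_cast
      rfl
    have h := hasSum_fintype (fun c : ι k => v ^ c.1.length / (c.1.length : ℂ))
    rw [Finset.sum_congr rfl (fun c _ => h1 c), Finset.sum_const, Finset.card_univ, nsmul_eq_mul,
      ← Nat.card_eq_fintype_card, card_cycleChain] at h
    exact h
  -- Absolute convergence at `u` is the convergence of the trace series at `‖u‖`.
  have hnorm : Summable fun x : Σ k, ι k => ‖u ^ x.2.1.length / (x.2.1.length : ℂ)‖ := by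
    rw [summable_sigma_of_nonneg fun _ => norm_nonneg _]
    refine ⟨fun k => Summable.of_finite, ?_⟩
    refine hM.summable.norm.congr fun k => ?_
    rw [← (hfib _ k).tsum_eq, tsum_fintype, tsum_fintype]
    have h2 : ∀ c : ι k, ((‖u‖ : ℝ) : ℂ) ^ c.1.length / (c.1.length : ℂ) =
        ((‖u ^ c.1.length / (c.1.length : ℂ)‖ : ℝ) : ℂ) := by
      intro c
      rw [norm_div, norm_pow, Complex.norm_natCast]
      push_cast
      rfl
    rw [Finset.sum_congr rfl fun c _ => h2 c, ← Complex.ofReal_sum, Complex.norm_real,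
      Real.norm_of_nonneg (Finset.sum_nonneg fun _ _ => norm_nonneg _)]
  rw [← e.hasSum_iff]
  exact HasSum.sigma_of_hasSum hL (fun k => hfib u k) hnorm.of_norm

/-- A closed chain is a positive power of exactly one aperiodic closed chain. -/
noncomputable def aperiodicPowerEquiv (r : α → α → Prop) :
    {c : List α // c.IsAperiodic ∧ Cycle.Chain r (c : Cycle α)} × ℕ ≃
      {c : List α // c ≠ [] ∧ Cycle.Chain r (c : Cycle α)} :=
  Equiv.ofBijective
    (fun x => ⟨x.1.1.power (x.2 + 1), by simp [List.power_succ, x.1.2.1.ne_nil],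
      (List.cycleChain_power_succ x.1.2.1.ne_nil).2 x.1.2.2⟩) <| by
    constructor
    · rintro ⟨⟨b, hb, hbc⟩, m⟩ ⟨⟨b', hb', hbc'⟩, m'⟩ h
      obtain ⟨rfl, rfl⟩ := List.power_succ_inj hb hb' (congrArg Subtype.val h)
      rfl
    · rintro ⟨c, hc, hcc⟩
      obtain ⟨b, m, hb, rfl⟩ := List.exists_isAperiodic_power hc
      exact ⟨⟨⟨b, hb, (List.cycleChain_power_succ hb.ne_nil).1 hcc⟩, m⟩, rfl⟩

/-- The aperiodic closed chains in the rotation class of `p` are as many as the length of `p`. -/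
theorem card_aperiodic_fiber (r : α → α → Prop)
    (p : {p : Cycle α // ∃ c : List α,
      (c.IsAperiodic ∧ Cycle.Chain r (c : Cycle α)) ∧ (c : Cycle α) = p}) :
    Nat.card {c : {c : List α // c.IsAperiodic ∧ Cycle.Chain r (c : Cycle α)} //
      (c.1 : Cycle α) = p.1} = p.1.length := by
  obtain ⟨p, c, ⟨hc, hcc⟩, rfl⟩ := p
  rw [Cycle.length_coe, ← hc.card_isRotated]
  refine Nat.card_congr
    { toFun := fun b => ⟨b.1.1, Cycle.coe_eq_coe.1 b.2⟩
      invFun := fun b => ⟨⟨b.1, ?_, ?_⟩, Cycle.coe_eq_coe.2 b.2⟩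
      left_inv := fun b => rfl
      right_inv := fun b => rfl }
  · obtain ⟨k, hk⟩ := b.2.symm
    exact hk ▸ hc.rotate k
  · rw [Cycle.coe_eq_coe.2 b.2]
    exact hcc

/-- The Euler product over the rotation classes of aperiodic closed chains converges near `0` to the
inverse of the determinant. -/
theorem eventually_hasProd_rotationClass [Fintype α] [DecidableEq α] (r : α → α → Prop) :
    ∀ᶠ u in 𝓝 (0 : ℂ),
      HasProd (fun p : {p : Cycle α // ∃ c : List α,
          (c.IsAperiodic ∧ Cycle.Chain r (c : Cycle α)) ∧ (c : Cycle α) = p} =>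
        (1 - u ^ p.1.length)⁻¹) ((1 - u • relMatrix r).det)⁻¹ := by
  filter_upwards [eventually_hasSum_cycleChain r, Metric.ball_mem_nhds (0 : ℂ) one_pos] with
    u ⟨L, hL, hexp⟩ hu
  rw [mem_ball_zero_iff] at hu
  set κ := {p : Cycle α // ∃ c : List α,
    (c.IsAperiodic ∧ Cycle.Chain r (c : Cycle α)) ∧ (c : Cycle α) = p}
  have hpow : ∀ {k : ℕ}, 0 < k → ‖u ^ k‖ < 1 := fun hk => by
    rw [norm_pow]
    exact pow_lt_one₀ (norm_nonneg u) hu hk.ne'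
  have hpos : ∀ p : κ, 0 < p.1.length := by
    rintro ⟨p, c, ⟨hc, -⟩, rfl⟩
    exact List.length_pos_of_ne_nil hc.ne_nil
  -- For fixed `b`, the powers of `b` sum up to the logarithm series.
  have h1 : HasSum (fun b : {c : List α // c.IsAperiodic ∧ Cycle.Chain r (c : Cycle α)} =>
      -Complex.log (1 - u ^ b.1.length) / (b.1.length : ℂ)) L := by
    rw [← (aperiodicPowerEquiv r).hasSum_iff] at hL
    refine hL.prod_fiberwise fun b => ?_
    have hb : 0 < b.1.length := List.length_pos_of_ne_nil b.2.1.ne_nil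
    have heq : ∀ m : ℕ, u ^ (b.1.power (m + 1)).length / ((b.1.power (m + 1)).length : ℂ) =
        (u ^ b.1.length) ^ (m + 1) / (m + 1) / (b.1.length : ℂ) := by
      intro m
      rw [List.length_power, div_div, ← pow_mul, mul_comm b.1.length]
      push_cast
      rfl
    have h := (Complex.hasSum_taylorSeries_neg_log' (hpow hb)).div_const (b.1.length : ℂ)
    rw [← funext heq] at h
    exact h
  let f : {c : List α // c.IsAperiodic ∧ Cycle.Chain r (c : Cycle α)} → κ :=
    fun b => ⟨(b.1 : Cycle α), b.1, b.2, rfl⟩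
  have h2 : HasSum (fun p : κ => -Complex.log (1 - u ^ p.1.length)) L := by
    rw [← (Equiv.sigmaFiberEquiv f).hasSum_iff] at h1
    refine h1.sigma fun p => ?_
    have hcard : Nat.card {b // f b = p} = p.1.length := by
      rw [← card_aperiodic_fiber r p]
      exact Nat.card_congr (Equiv.subtypeEquivRight fun b => Subtype.ext_iff)
    have hlen : ∀ b : {b // f b = p}, b.1.1.length = p.1.length := fun b =>
      congrArg (fun q : κ => q.1.length) b.2
    have := Nat.finite_of_card_ne_zero (hcard.trans_ne (hpos p).ne')
    have := Fintype.ofFinite {b // f b = p}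
    have h := hasSum_fintype (fun b : {b // f b = p} =>
      -Complex.log (1 - u ^ b.1.1.length) / (b.1.1.length : ℂ))
    rw [Finset.sum_congr rfl (fun b _ => by rw [hlen b]), Finset.sum_const, Finset.card_univ,
      ← Nat.card_eq_fintype_card, hcard, nsmul_eq_mul,
      mul_div_cancel₀ _ (Nat.cast_ne_zero.2 (hpos p).ne')] at h
    exact h
  have h3 := h2.cexp
  rw [hexp] at h3
  have heq : ∀ p : κ, (1 - u ^ p.1.length)⁻¹ =
      (Complex.exp ∘ fun p : κ => -Complex.log (1 - u ^ p.1.length)) p := by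
    intro p
    have hne : 1 - u ^ p.1.length ≠ 0 := fun h0 => by
      have := hpow (hpos p)
      rw [← sub_eq_zero.1 h0, norm_one] at this
      exact lt_irrefl _ this
    rw [Function.comp_apply, Complex.exp_neg, Complex.exp_log hne]
  rw [← funext heq] at h3
  exact h3

end EulerProduct

/-! ### Meromorphic functions in normal form -/

/-- The identity theorem for meromorphic functions in normal form on the plane. -/
theorem MeromorphicNFOn.eq_of_eventuallyEq {f g : ℂ → ℂ} (hf : MeromorphicNFOn f Set.univ)
    (hg : MeromorphicNFOn g Set.univ) {x₀ : ℂ} (h : f =ᶠ[𝓝 x₀] g) : f = g := by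
  funext x
  have hfg : MeromorphicOn (f - g) Set.univ := hf.meromorphicOn.sub hg.meromorphicOn
  have h0 : meromorphicOrderAt (f - g) x₀ = ⊤ := by
    rw [meromorphicOrderAt_eq_top_iff]
    filter_upwards [h.filter_mono nhdsWithin_le_nhds] with z hz
    simp [hz]
  have hx : meromorphicOrderAt (f - g) x = ⊤ := by
    by_contra hne
    exact hfg.meromorphicOrderAt_ne_top_of_isPreconnected isPreconnected_univ (Set.mem_univ x)
      (Set.mem_univ x₀) hne h0
  rw [meromorphicOrderAt_eq_top_iff] at hx
  refine (((hf (Set.mem_univ x)).eventuallyEq_nhdsNE_iff_eventuallyEq_nhds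
    (hg (Set.mem_univ x))).1 ?_).eq_of_nhds
  filter_upwards [hx] with z hz
  exact sub_eq_zero.1 hz

/-! ### Comparison of infinite products -/

/-- Two products of positive reals that agree in value and are comparable factor by factor agree in
each factor: a strict inequality in one factor would survive in the limit, as the value is not `0`. -/
theorem HasProd.eq_of_le_of_pos {ι : Type*} {F G : ι → ℝ} {R : ℝ} (hF : HasProd F R)
    (hG : HasProd G R) (hpos : ∀ i, 0 < G i) (hle : ∀ i, G i ≤ F i) (hR : 0 < R) (i : ι) :
    F i = G i := by
  classical
  refine le_antisymm ?_ (hle i)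
  have hlim : F i / G i * R ≤ R := by
    refine le_of_tendsto_of_tendsto (Tendsto.const_mul (F i / G i) hG) hF ?_
    filter_upwards [eventually_ge_atTop {i}] with s hs
    have hi : i ∈ s := hs (Finset.mem_singleton_self i)
    rw [← Finset.mul_prod_erase s F hi, ← Finset.mul_prod_erase s G hi, ← mul_assoc,
      div_mul_cancel₀ _ (hpos i).ne']
    exact mul_le_mul_of_nonneg_left
      (Finset.prod_le_prod (fun j _ => (hpos j).le) fun j _ => hle j)
      ((hpos i).le.trans (hle i))
  have := le_of_mul_le_mul_right (hlim.trans_eq (one_mul R).symm) hR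
  rwa [div_le_one (hpos i)] at this

namespace MultiHypergraph

variable {V E : Type*} (H : MultiHypergraph V E)

/-! ### Primitive cycles as aperiodic closed chains of arcs -/

/-- The arc `(v, e)` of a hypergraph may be followed by the arc `(w, f)` if `w` is another
hypervertex of `e` and the hyperedge changes, `e ≠ f`. -/
def ArcRel (x y : V × E) : Prop :=
  x.1 ∈ H.edge x.2 ∧ (y.1 ∈ H.edge x.2 ∧ x.1 ≠ y.1) ∧ x.2 ≠ y.2

theorem not_hasHyperedgeBacktracking_iff {c : List (V × E)} :
    ¬ HasHyperedgeBacktracking c ↔ List.IsChain (fun x y : V × E => x.2 ≠ y.2) c := by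
  rw [List.isChain_iff_forall_rel_of_append_cons_cons]
  constructor
  · rintro h x y s t rfl hxy
    exact h ⟨x, y, ⟨s, t, by simp⟩, hxy⟩
  · rintro h ⟨x, y, ⟨s, t, rfl⟩, hxy⟩
    exact h (List.append_assoc s [x, y] t) hxy

theorem isTailless_iff {c : List (V × E)} (hc : c ≠ []) :
    IsTailless c ↔ Cycle.Chain (fun x y : V × E => x.2 ≠ y.2) (c : Cycle (V × E)) := by
  have h2 : multiple 2 c = c ++ c := by simp [multiple, List.replicate_succ]
  rw [IsTailless, not_hasHyperedgeBacktracking_iff, h2, List.isChain_append,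
    List.cycleChain_iff hc, and_self_left]

/-- Hyperedge backtracking of `c` and of its double is excluded at once by the condition that
cyclically consecutive hyperedges differ. In the last condition of primitivity, a list some power of
which is a closed path is a closed path itself. -/
theorem isPrimitiveCycle_iff {c : List (V × E)} :
    H.IsPrimitiveCycle c ↔ c.IsAperiodic ∧ Cycle.Chain H.ArcRel (c : Cycle (V × E)) := by
  constructor
  · rintro ⟨⟨hne, hmem, hch⟩, -, htl, hprim⟩
    constructor
    · rintro b m hm rfl
      have hb : b ≠ [] := by rintro rfl; exact hne (by simp [List.power])
      obtain ⟨m, rfl⟩ : ∃ k, m = k + 1 := ⟨m - 1, by omega⟩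
      refine hprim ⟨b, m + 1, ⟨hb, fun x hx => hmem x ?_, ?_⟩, hm, rfl⟩
      · rw [List.power_succ]
        exact List.mem_append_left _ hx
      · exact (List.cycleChain_power_succ hb).1 hch
    · rw [isTailless_iff hne, List.cycleChain_iff hne] at htl
      rw [List.cycleChain_iff hne] at hch ⊢
      refine ⟨?_, fun x hx y hy => ⟨hmem x (List.mem_of_getLast? hx), hch.2 x hx y hy,
        htl.2 x hx y hy⟩⟩
      refine List.isChain_iff_forall_rel_of_append_cons_cons.2 fun x y s t h => ?_
      exact ⟨hmem x (by simp [h]), List.isChain_iff_forall_rel_of_append_cons_cons.1 hch.1 h,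
        List.isChain_iff_forall_rel_of_append_cons_cons.1 htl.1 h⟩
  · rintro ⟨hap, hch⟩
    have hne := hap.ne_nil
    have htl : Cycle.Chain (fun x y : V × E => x.2 ≠ y.2) (c : Cycle (V × E)) :=
      hch.imp fun _ _ h => h.2.2
    refine ⟨⟨hne, fun x hx => ?_, hch.imp fun _ _ h => h.2.1⟩,
      not_hasHyperedgeBacktracking_iff.2 ((List.cycleChain_iff hne).1 htl).1,
      (isTailless_iff hne).2 htl, ?_⟩
    · rw [List.cycleChain_iff hne] at hch
      obtain ⟨s, t, rfl⟩ := List.append_of_mem hx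
      rcases t with _ | ⟨y, t⟩
      · exact (hch.2 x (by simp) _ (List.head?_eq_some_head hne)).1
      · exact (List.isChain_iff_forall_rel_of_append_cons_cons.1 hch.1 rfl).1
    · rintro ⟨b, m, -, hm, h⟩
      exact hap b m hm h

/-! ### The zeta function -/

theorem eventually_hasProd_primeCycle [Fintype V] [Fintype E] [DecidableEq V] [DecidableEq E] :
    ∀ᶠ u in 𝓝 (0 : ℂ), HasProd (fun p : H.PrimeCycle => (1 - u ^ p.length)⁻¹)
      ((1 - u • relMatrix H.ArcRel).det)⁻¹ := by
  filter_upwards [eventually_hasProd_rotationClass H.ArcRel] with u hu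
  let e : H.PrimeCycle ≃ {p : Cycle (V × E) // ∃ c : List (V × E),
      (c.IsAperiodic ∧ Cycle.Chain H.ArcRel (c : Cycle (V × E))) ∧ (c : Cycle (V × E)) = p} :=
    Equiv.subtypeEquivRight fun p => exists_congr fun c =>
      and_congr_left fun _ => H.isPrimitiveCycle_iff
  exact e.hasProd_iff.2 hu

/-- The continuation is the inverse of a polynomial. At the zeros of the polynomial the convention
`0⁻¹ = 0` yields the value that the normal form prescribes at a pole. -/
theorem isZeta_inv_det [Fintype V] [Fintype E] [DecidableEq V] [DecidableEq E] :
    H.IsZeta fun u => ((1 - u • relMatrix H.ArcRel).det)⁻¹ :=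
  ⟨meromorphicNFOn_fun_inv.2 (AnalyticOnNhd.meromorphicNFOn fun u _ =>
    analyticAt_det_one_sub_smul _ u), H.eventually_hasProd_primeCycle⟩

variable {H}

theorem IsZeta.unique {Z Z' : ℂ → ℂ} (hZ : H.IsZeta Z) (hZ' : H.IsZeta Z') : Z = Z' := by
  refine hZ.1.eq_of_eventuallyEq hZ'.1 (x₀ := 0) ?_
  filter_upwards [hZ.2, hZ'.2] with u h h'
  exact h.unique h'

theorem IsZeta.zeta_eq {Z : ℂ → ℂ} (hZ : H.IsZeta Z) : H.zeta = Z := by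
  have h : ∃ Z, H.IsZeta Z := ⟨Z, hZ⟩
  rw [zeta, dif_pos h]
  exact h.choose_spec.unique hZ

theorem PrimeCycle.length_pos (p : H.PrimeCycle) : 0 < p.length := by
  obtain ⟨p, c, hc, rfl⟩ := p
  exact List.length_pos_of_ne_nil hc.1.1

theorem IsZeta.eventually_hasProd_neg {Z : ℂ → ℂ} (hZ : H.IsZeta Z) :
    ∀ᶠ u in 𝓝 (0 : ℂ), HasProd (fun p : H.PrimeCycle => (1 - (-u) ^ p.length)⁻¹) (Z (-u)) := by
  have h : Tendsto (fun u : ℂ => -u) (𝓝 0) (𝓝 0) := by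
    simpa using (continuous_neg (G := ℂ)).tendsto 0
  exact h.eventually hZ.2

/-- At a small `t > 0`, no Euler factor is smaller than its counterpart at `-t`, and it is larger if
the length is odd. So an odd prime cycle makes the product at `t` larger than the one at `-t`. -/
theorem IsZeta.even_length {Z : ℂ → ℂ} (hZ : H.IsZeta Z) (heven : ∀ u, Z u = Z (-u))
    (p : H.PrimeCycle) : Even p.length := by
  obtain ⟨ε, hε, hball⟩ := Metric.eventually_nhds_iff_ball.1 (hZ.2.and hZ.eventually_hasProd_neg)
  obtain ⟨t, ht0, ht⟩ := exists_between (lt_min hε one_pos)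
  obtain ⟨htε, ht1⟩ := lt_min_iff.1 ht
  obtain ⟨h1, h2⟩ := hball (t : ℂ) (by simpa [abs_of_pos ht0] using htε)
  rw [← heven] at h2
  have hF := h1.norm
  have hG := h2.norm
  have hlt : ∀ q : H.PrimeCycle, t ^ q.length < 1 := fun q =>
    pow_lt_one₀ ht0.le ht1 q.length_pos.ne'
  have habs : ∀ q : H.PrimeCycle, |(-t) ^ q.length| = t ^ q.length := fun q => by
    rw [abs_pow, abs_neg, abs_of_pos ht0]
  have hFq : ∀ q : H.PrimeCycle, ‖(1 - (t : ℂ) ^ q.length)⁻¹‖ = (1 - t ^ q.length)⁻¹ := by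
    intro q
    rw [norm_inv, ← Complex.ofReal_pow, ← Complex.ofReal_one, ← Complex.ofReal_sub,
      Complex.norm_real, Real.norm_of_nonneg (sub_nonneg.2 (hlt q).le)]
  have hGlt : ∀ q : H.PrimeCycle, 0 < 1 - (-t) ^ q.length := fun q => by
    have := le_abs_self ((-t) ^ q.length)
    rw [habs] at this
    linarith [hlt q]
  have hGq : ∀ q : H.PrimeCycle, ‖(1 - (-(t : ℂ)) ^ q.length)⁻¹‖ = (1 - (-t) ^ q.length)⁻¹ := by
    intro q
    rw [norm_inv, ← Complex.ofReal_neg, ← Complex.ofReal_pow, ← Complex.ofReal_one,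
      ← Complex.ofReal_sub, Complex.norm_real, Real.norm_of_nonneg (hGlt q).le]
  rw [funext hFq] at hF
  rw [funext hGq] at hG
  have hR : 0 < ‖Z t‖ := by
    refine one_pos.trans_le (ge_of_tendsto' hF fun s =>
      Finset.prod_const_one.symm.trans_le
        (Finset.prod_le_prod (fun _ _ => zero_le_one) fun q _ => ?_))
    refine (one_le_inv₀ (sub_pos.2 (hlt q))).2 ?_
    linarith [pow_pos ht0 q.length]
  have heq := hF.eq_of_le_of_pos hG (fun q => inv_pos.2 (hGlt q)) (fun q => by
    refine inv_anti₀ (sub_pos.2 (hlt q)) (sub_le_sub_left ?_ 1)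
    rw [← habs]
    exact le_abs_self _) hR p
  by_contra hodd
  rw [Nat.not_even_iff_odd] at hodd
  have h3 := inv_injective heq
  rw [hodd.neg_pow] at h3
  linarith [pow_pos ht0 p.length]

end MultiHypergraph

theorem mainTheorem10 {V E : Type*} [Finite V] [Finite E] (H : MultiHypergraph V E) :
    (∃! Z : ℂ → ℂ, H.IsZeta Z) ∧
      ((∀ u : ℂ, H.zeta u = H.zeta (-u)) ↔
        ∀ c : List (V × E), H.IsPrimitiveCycle c → Even c.length) := by
  classical
  have := Fintype.ofFinite V
  have := Fintype.ofFinite E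
  have hZ := H.isZeta_inv_det
  refine ⟨⟨_, hZ, fun Z h => h.unique hZ⟩, ?_⟩
  rw [hZ.zeta_eq]
  constructor
  · intro heven c hc
    exact hZ.even_length heven ⟨c, c, hc, rfl⟩
  · intro hlen
    have hd : ∀ u, AnalyticAt ℂ (fun v : ℂ => (1 - v • relMatrix H.ArcRel).det) u :=
      analyticAt_det_one_sub_smul _
    have hd' : ∀ u, AnalyticAt ℂ (fun v : ℂ => (1 - (-v) • relMatrix H.ArcRel).det) u :=
      fun u => (hd (-u)).fun_comp analyticAt_id.neg
    have heq := AnalyticOnNhd.eq_of_eventuallyEq (fun u _ => hd u) (fun u _ => hd' u) (z₀ := 0) (by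
      filter_upwards [hZ.2, hZ.eventually_hasProd_neg] with u h h'
      have hfac : ∀ p : H.PrimeCycle, (1 - (-u) ^ p.length)⁻¹ = (1 - u ^ p.length)⁻¹ := by
        rintro ⟨p, c, hc, rfl⟩
        have : Even (MultiHypergraph.PrimeCycle.length (H := H) ⟨(c : Cycle (V × E)), c, hc, rfl⟩) := hlen c hc
        rw [this.neg_pow]
      rw [funext hfac] at h'
      exact inv_injective (h.unique h'))
    exact fun u => congrArg Inv.inv (congrFun heq u)
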